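/- Fix an integer $k\ge 1$ and $\sigma>0$. Let $x_0=0\in\mathbb{R}^k$, let $X_1,X_2,\dots$ be drawn uniformly from the closed Euclidean unit ball of $\mathbb{R}^k$, let $\varepsilon_{0i},\varepsilon_{i0}\sim\mathcal{N}(0,\sigma^2 I_k)$ for $i\ge 1$, all of these random vectors being independent, and put $Y_{0i}=x_0+\varepsilon_{0i}$ and $Y_{i0}=X_i+\varepsilon_{i0}$. For positive integers $m,n$ define the expected distance to the match from $m$ in-person draws and from an AI platform with $n$ candidates by \[ d^{\mathrm{IP}}_k(m)=\mathbb{E}\Big[\min_{1\le i\le m}\|X_i-x_0\|\Big],\qquad d^{\mathrm{AI}}_k(n)=\mathbb{E}\big[\|X_{i^*_n}-x_0\|\big],\quad i^*_n=\operatorname*{arg\,min}_{1\le i\le n}\|Y_{0i}-Y_{i0}\| \] (ties, which have probability zero, are broken in favor of the smallest index). The AI-equivalent sample size $m^*_k$ is the smallest positive integer $m$ such that $d^{\mathrm{IP}}_k(m)<d^{\mathrm{AI}}_k(n)$ for all positive integers $n$, and $m^*_k=\infty$ if there is no such $m$. Then $m^*_k$ is finite. That is, $m^*_k$ is a positive integer,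 and with $m=m^*_k$ in-person draws the expected distance is strictly smaller than on the AI platform with any number of candidates: $d^{\mathrm{IP}}_k(m^*_k)<d^{\mathrm{AI}}_k(n)$ for every integer $n\ge 1$. -/

import Mathlib

open MeasureTheory ProbabilityTheory

noncomputable section

namespace CloneSearch

/-- The space of personality vectors, `ℝ^k` with the Euclidean norm. -/
abbrev Personality (k : ℕ) : Type := EuclideanSpace ℝ (Fin k)

/-- The uniform distribution on the closed Euclidean unit ball of `ℝ^k`. -/
def uniformBall (k : ℕ) : Measure (Personality k) :=
  ProbabilityTheory.cond volume (Metric.closedBall 0 1)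

/-- The Gaussian distribution `N(0, σ² I_k)` of the error of one clone. -/
def cloneNoise (k : ℕ) (σ : ℝ) : Measure (Personality k) :=
  multivariateGaussian 0 (σ ^ 2 • (1 : Matrix (Fin k) (Fin k) ℝ))

/-- Subject's personality vector, normalized to the origin. -/
def subject (k : ℕ) : Personality k := 0

/-! ### The in-person regime -/

/-- The joint law of the `m` independent individuals `X_1, …, X_m` whom Subject meets. -/
def inPersonLaw (k m : ℕ) : Measure (Fin m → Personality k) :=
  Measure.pi fun _ => uniformBall k

/-- The expected distance `E[min_i ‖X_i - x_0‖]` between Subject and the closest of `m` individuals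
met in person (the infimum is a minimum over a finite nonempty set, as `m ≥ 1`). -/
def inPersonDist (k : ℕ) (m : ℕ+) : ℝ :=
  ∫ x, ⨅ i, ‖x i - subject k‖ ∂(inPersonLaw k m)

/-! ### The AI representation regime -/

/-- The random data of one interaction on the platform: the candidate's personality `X_i`, the
error `ε_{0i}` of Subject's clone and the error `ε_{i0}` of the candidate's clone. -/
abbrev Interaction (k : ℕ) : Type := Personality k × Personality k × Personality k

namespace Interaction

variable {k : ℕ} (w : Interaction k)

/-- The candidate's true personality `X_i`. -/
def candidate : Personality k := w.1

/-- Subject's clone `Y_{0i} = x_0 + ε_{0i}` in this interaction. -/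
def subjectClone : Personality k := subject k + w.2.1

/-- The candidate's clone `Y_{i0} = X_i + ε_{i0}` in this interaction. -/
def candidateClone : Personality k := w.1 + w.2.2

/-- The distance `‖Y_{0i} - Y_{i0}‖` between the two clones, which the platform observes. -/
def cloneDist : ℝ := ‖subjectClone w - candidateClone w‖

end Interaction

/-- The joint law of `n` interactions: all the `X_i`, `ε_{0i}`, `ε_{i0}` are independent, the `X_i`
are uniform on the unit ball, and the errors have law `N(0, σ² I_k)`. -/
def platformLaw (k : ℕ) (σ : ℝ) (n : ℕ) : Measure (Fin n → Interaction k) :=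
  Measure.pi fun _ => (uniformBall k).prod ((cloneNoise k σ).prod (cloneNoise k σ))

open Classical in
/-- The index at which a nonempty finite list of reals is smallest (the first such index, if there
are several). -/
def argmin {n : ℕ} [NeZero n] (d : Fin n → ℝ) : Fin n :=
  Fin.find (fun i => ∀ j, d i ≤ d j) (Finite.exists_min d)

/-- The index `i*_n` of the candidate whose clone is closest to Subject's clone. -/
def matchIndex {k n : ℕ} [NeZero n] (w : Fin n → Interaction k) : Fin n :=
  argmin fun i => (w i).cloneDist

/-- The expected true distance `E[‖X_{i*_n} - x_0‖]` between Subject and the match that the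
platform selects among `n` candidates. -/
def platformDist (k : ℕ) (σ : ℝ) (n : ℕ+) : ℝ :=
  ∫ w, ‖(w (matchIndex w)).candidate - subject k‖ ∂(platformLaw k σ n)

/-! ### The AI-equivalent sample size -/

/-- `m` in-person draws give a strictly smaller expected distance than the platform with any
number of candidates. -/
def BeatsPlatform (k : ℕ) (σ : ℝ) (m : ℕ+) : Prop :=
  ∀ n : ℕ+, inPersonDist k m < platformDist k σ n

/-- The AI-equivalent sample size: the smallest positive integer `m` such that `m` in-person draws
beat the platform, and `∞` if there is none. -/
def aiEquivalentSampleSize (k : ℕ) (σ : ℝ) : ℕ∞ :=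
  ⨅ (m : ℕ+) (_ : BeatsPlatform k σ m), ((m : ℕ) : ℕ∞)

end CloneSearch

end

/-!
The in-person distance tends to `0` as `m` grows, since every neighborhood of the origin has positive
probability under `uniformBall k`. So it is enough to bound the platform distance from below by a
positive constant that does not depend on the number `n` of candidates.

The platform sees only the clone distances `‖Y_{0i} - Y_{i0}‖`, and no observation of such a distance
makes it likely that the candidate is very close to Subject. Precisely, let `F x` be the probability
that the clone distance lies in a set `S`, given that the candidate is at `x`
(`CloneSearch.cloneDistProb`). By the Cameron–Martin formula and the symmetry of the noise,
`F x = exp (-‖x‖² / (2σ²)) * ∫ cosh (⟪x, z⟫ / σ²)`, the integral being over the noise pairs `(u, z)`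
with `‖u - z‖ ∈ S`. As `cosh` increases along rays, `F x ≤ exp (1 / (2σ²)) * F (ρ⁻¹ • x)` for
`‖x‖ ≤ ρ ≤ 1` (`CloneSearch.cloneDistProb_le_smul`), and the substitution `x ↦ ρ⁻¹ • x` gives
`∫_{‖x‖ ≤ ρ} F ≤ exp (1 / (2σ²)) * ρ ^ k * ∫_{‖x‖ ≤ 1} F`. For small `ρ` the constant is at most
`1 / 2`, so that the candidate is within `ρ` of Subject with conditional probability at most `1 / 2`,
whatever the clone distance (`CloneSearch.interactionLaw_inter_le_half`).

The interactions are independent and the selected index is a function of the clone distances, so the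
bound passes to the match (`CloneSearch.platformLaw_match_mem_closedBall_le_half`), and the platform
distance is at least `ρ / 2` for every `n`.
-/

open MeasureTheory ProbabilityTheory
open scoped ENNReal RealInnerProductSpace

noncomputable section

namespace CloneSearch

/-! ### The density of the clone noise -/

theorem charFun_cloneNoise (k : ℕ) (σ : ℝ) (t : Personality k) :
    charFun (cloneNoise k σ) t = Complex.exp (-(σ ^ 2 * ‖t‖ ^ 2 / 2 : ℝ)) := by
  have hS : (σ ^ 2 • (1 : Matrix (Fin k) (Fin k) ℝ)).PosSemidef :=
    Matrix.PosSemidef.one.smul (sq_nonneg σ)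
  rw [cloneNoise, charFun_multivariateGaussian hS]
  have h : t.ofLp ⬝ᵥ ((σ ^ 2 • (1 : Matrix (Fin k) (Fin k) ℝ)).mulVec t.ofLp)
      = σ ^ 2 * ‖t‖ ^ 2 := by
    rw [EuclideanSpace.real_norm_sq_eq]
    simp [Matrix.smul_mulVec, dotProduct, pow_two, Finset.mul_sum, mul_left_comm]
  rw [h]
  simp

instance isProbabilityMeasure_cloneNoise (k : ℕ) (σ : ℝ) :
    IsProbabilityMeasure (cloneNoise k σ) := by
  unfold cloneNoise; infer_instance

theorem integrable_exp_neg_mul_sq_norm (k : ℕ) {b : ℝ} (hb : 0 < b) :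
    Integrable (fun v : Personality k => Real.exp (-b * ‖v‖ ^ 2)) := by
  have h := (GaussianFourier.integrable_cexp_neg_mul_sq_norm_add (V := Personality k) (b := (b : ℂ))
    (by simpa using hb) 0 0).re
  refine h.congr (.of_forall fun v => ?_)
  have : (-(b : ℂ) * (‖v‖ : ℂ) ^ 2 + 0 * ((⟪(0 : Personality k), v⟫ : ℝ) : ℂ))
      = ((-b * ‖v‖ ^ 2 : ℝ) : ℂ) := by push_cast; ring
  simp only [this, ← Complex.ofReal_exp]
  exact Complex.ofReal_re _

/-- The clone noise has a density proportional to `exp (-‖v‖² / (2σ²))`. The normalizing constant is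
left implicit, as it cancels in the shift formula. -/
theorem exists_cloneNoise_eq_smul_withDensity (k : ℕ) {σ : ℝ} (hσ : 0 < σ) :
    ∃ c : ℝ≥0∞, cloneNoise k σ = c • (volume : Measure (Personality k)).withDensity
      fun v => ENNReal.ofReal (Real.exp (-(1 / (2 * σ ^ 2)) * ‖v‖ ^ 2)) := by
  set b : ℝ := 1 / (2 * σ ^ 2) with hb_def
  have hb : 0 < b := by positivity
  set C : ℝ := (Real.pi / b) ^ ((k : ℝ) / 2) with hC_def
  have hC : 0 < C := by positivity
  set ν := (volume : Measure (Personality k)).withDensity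
      fun v => ENNReal.ofReal (Real.exp (-b * ‖v‖ ^ 2)) with hν
  have hfin : IsFiniteMeasure ν := by
    refine isFiniteMeasure_withDensity ?_
    exact (integrable_exp_neg_mul_sq_norm k hb).lintegral_lt_top.ne
  have key : ν = ENNReal.ofReal C • cloneNoise k σ := by
    have : IsFiniteMeasure (ENNReal.ofReal C • cloneNoise k σ) :=
      Measure.smul_finite _ ENNReal.ofReal_ne_top
    refine Measure.ext_of_charFun (funext fun t => ?_)
    have h1 : charFun (ENNReal.ofReal C • cloneNoise k σ) t = C * charFun (cloneNoise k σ) t := by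
      rw [charFun_apply, integral_smul_measure, ENNReal.toReal_ofReal hC.le, ← charFun_apply,
        Complex.real_smul]
    rw [h1, charFun_cloneNoise, charFun_apply, hν,
      integral_withDensity_eq_integral_toReal_smul (by fun_prop) (by simp)]
    have h2 := GaussianFourier.integral_cexp_neg_mul_sq_norm_add (V := Personality k) (b := (b : ℂ))
      (by simpa using hb) Complex.I t
    have h3 : (fun v : Personality k => Complex.exp (-(b : ℂ) * ‖v‖ ^ 2 + Complex.I * ⟪t, v⟫))
        = fun v => (ENNReal.ofReal (Real.exp (-b * ‖v‖ ^ 2))).toReal •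
          Complex.exp (⟪v, t⟫ * Complex.I) := by
      funext v
      rw [ENNReal.toReal_ofReal (Real.exp_pos _).le, Complex.real_smul, Complex.exp_add,
        real_inner_comm, mul_comm Complex.I]
      push_cast
      rfl
    rw [← h3, h2, hC_def, Complex.ofReal_cpow (by positivity)]
    congr 1
    · simp
    · congr 1
      have : (σ : ℂ) ≠ 0 := by exact_mod_cast hσ.ne'
      rw [hb_def]
      push_cast
      rw [Complex.I_sq]
      field_simp
      ring
  refine ⟨(ENNReal.ofReal C)⁻¹, ?_⟩
  rw [key, smul_smul, ENNReal.inv_mul_cancel (by simpa using hC) ENNReal.ofReal_ne_top, one_smul]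

/-- The Cameron–Martin formula for the clone noise. -/
theorem lintegral_cloneNoise_shift (k : ℕ) {σ : ℝ} (hσ : 0 < σ) (x : Personality k)
    {g : Personality k → ℝ≥0∞} (hg : Measurable g) :
    ∫⁻ z, g (x + z) ∂(cloneNoise k σ) =
      ENNReal.ofReal (Real.exp (-(1 / (2 * σ ^ 2)) * ‖x‖ ^ 2)) *
        ∫⁻ z, g z * ENNReal.ofReal (Real.exp (⟪x, z⟫ / σ ^ 2)) ∂(cloneNoise k σ) := by
  obtain ⟨c, hc⟩ := exists_cloneNoise_eq_smul_withDensity k hσ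
  rw [hc, lintegral_smul_measure, lintegral_smul_measure,
    lintegral_withDensity_eq_lintegral_mul _ (by fun_prop) (by fun_prop),
    lintegral_withDensity_eq_lintegral_mul _ (by fun_prop) (by fun_prop),
    smul_eq_mul, smul_eq_mul, mul_left_comm (ENNReal.ofReal _) c]
  congr 1
  rw [← lintegral_const_mul _ (by fun_prop)]
  refine Eq.trans ?_ (lintegral_add_left_eq_self _ x)
  refine lintegral_congr fun z => ?_
  have hexp : Real.exp (-(1 / (2 * σ ^ 2)) * ‖z‖ ^ 2) =
      Real.exp (-(1 / (2 * σ ^ 2)) * ‖x‖ ^ 2) *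
        (Real.exp (-(1 / (2 * σ ^ 2)) * ‖x + z‖ ^ 2) * Real.exp (⟪x, x + z⟫ / σ ^ 2)) := by
    rw [← Real.exp_add, ← Real.exp_add, norm_add_sq_real, inner_add_right,
      real_inner_self_eq_norm_sq]
    congr 1
    field_simp
    ring
  simp only [Pi.mul_apply]
  rw [hexp, ENNReal.ofReal_mul (by positivity), ENNReal.ofReal_mul (by positivity)]
  ring

theorem map_neg_cloneNoise (k : ℕ) (σ : ℝ) :
    (cloneNoise k σ).map (fun z => -z) = cloneNoise k σ := by
  have : IsProbabilityMeasure ((cloneNoise k σ).map (fun z => -z)) :=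
    Measure.isProbabilityMeasure_map (by fun_prop)
  refine Measure.ext_of_charFun (funext fun t => ?_)
  have h := charFun_map_smul (μ := cloneNoise k σ) (-1) t
  simp only [neg_smul, one_smul] at h
  rw [h, charFun_cloneNoise, charFun_cloneNoise, norm_neg]

/-! ### The clone distance given the candidate's position -/

/-- The conditional probability, given that the candidate is at `x`, that the distance between the
two clones lies in `S`. -/
def cloneDistProb (k : ℕ) (σ : ℝ) (S : Set ℝ) (x : Personality k) : ℝ≥0∞ :=
  ((cloneNoise k σ).prod (cloneNoise k σ)) {p | ‖p.1 - (x + p.2)‖ ∈ S}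

theorem measurable_cloneDistProb (k : ℕ) (σ : ℝ) {S : Set ℝ} (hS : MeasurableSet S) :
    Measurable (cloneDistProb k σ S) := by
  have h : MeasurableSet
      {q : Personality k × Personality k × Personality k | ‖q.2.1 - (q.1 + q.2.2)‖ ∈ S} :=
    measurableSet_preimage (by fun_prop) hS
  exact measurable_measure_prodMk_left h

/-- The Gaussian shift formula moves `x` into the density; averaging with the image under
`(u, z) ↦ (-u, -z)`, which preserves the event, turns the exponential into a hyperbolic cosine. -/
theorem cloneDistProb_eq (k : ℕ) {σ : ℝ} (hσ : 0 < σ) {S : Set ℝ} (hS : MeasurableSet S)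
    (x : Personality k) :
    cloneDistProb k σ S x = ENNReal.ofReal (Real.exp (-(1 / (2 * σ ^ 2)) * ‖x‖ ^ 2)) *
      ∫⁻ p in {p : Personality k × Personality k | ‖p.1 - p.2‖ ∈ S},
        ENNReal.ofReal (Real.cosh (⟪x, p.2⟫ / σ ^ 2))
          ∂((cloneNoise k σ).prod (cloneNoise k σ)) := by
  set γ := cloneNoise k σ
  set A : Set (Personality k × Personality k) := {p | ‖p.1 - p.2‖ ∈ S}
  have hA : MeasurableSet A := measurableSet_preimage (by fun_prop) hS
  have hA' : MeasurableSet {p : Personality k × Personality k | ‖p.1 - (x + p.2)‖ ∈ S} :=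
    measurableSet_preimage (by fun_prop) hS
  set g : Personality k × Personality k → ℝ≥0∞ := A.indicator 1 with hg_def
  have hg : Measurable g := measurable_one.indicator hA
  have h1 : cloneDistProb k σ S x = ENNReal.ofReal (Real.exp (-(1 / (2 * σ ^ 2)) * ‖x‖ ^ 2)) *
      ∫⁻ p, g p * ENNReal.ofReal (Real.exp (⟪x, p.2⟫ / σ ^ 2)) ∂(γ.prod γ) := by
    rw [cloneDistProb, ← lintegral_indicator_one hA',
      lintegral_prod _ (measurable_one.indicator hA').aemeasurable,
      lintegral_prod _ (by fun_prop), ← lintegral_const_mul _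
        (Measurable.lintegral_prod_right (by fun_prop))]
    refine lintegral_congr fun u => ?_
    exact lintegral_cloneNoise_shift k hσ x (g := fun z => g (u, z)) (by fun_prop)
  have hneg : MeasurePreserving
      (Prod.map (fun z : Personality k => -z) (fun z : Personality k => -z))
      (γ.prod γ) (γ.prod γ) :=
    MeasurePreserving.prod ⟨by fun_prop, map_neg_cloneNoise k σ⟩
      ⟨by fun_prop, map_neg_cloneNoise k σ⟩
  have hgneg : ∀ p : Personality k × Personality k, g (-p.1, -p.2) = g p := by
    intro p
    have : (-p.1, -p.2) ∈ A ↔ p ∈ A := by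
      simp only [A, Set.mem_ofPred_eq]
      rw [neg_sub_neg, norm_sub_rev]
    by_cases hp : p ∈ A
    · rw [hg_def, Set.indicator_of_mem hp, Set.indicator_of_mem (this.2 hp)]; rfl
    · rw [hg_def, Set.indicator_of_notMem hp, Set.indicator_of_notMem (mt this.1 hp)]
  have h2 : ∫⁻ p, g p * ENNReal.ofReal (Real.exp (-(⟪x, p.2⟫ / σ ^ 2))) ∂(γ.prod γ) =
      ∫⁻ p, g p * ENNReal.ofReal (Real.exp (⟪x, p.2⟫ / σ ^ 2)) ∂(γ.prod γ) := by
    rw [← hneg.lintegral_comp (by fun_prop)]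
    refine lintegral_congr fun p => ?_
    simp only [Prod.map_apply', hgneg, inner_neg_right, neg_div, neg_neg]
  have h3 : ∫⁻ p in A, ENNReal.ofReal (Real.cosh (⟪x, p.2⟫ / σ ^ 2)) ∂(γ.prod γ) =
      ∫⁻ p, g p * ENNReal.ofReal (Real.exp (⟪x, p.2⟫ / σ ^ 2)) ∂(γ.prod γ) := by
    have : ∀ p : Personality k × Personality k,
        A.indicator (fun p => ENNReal.ofReal (Real.cosh (⟪x, p.2⟫ / σ ^ 2))) p =
        2⁻¹ * (g p * ENNReal.ofReal (Real.exp (⟪x, p.2⟫ / σ ^ 2)) +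
          g p * ENNReal.ofReal (Real.exp (-(⟪x, p.2⟫ / σ ^ 2)))) := by
      intro p
      rw [← mul_add, ← ENNReal.ofReal_add (by positivity) (by positivity)]
      by_cases hp : p ∈ A
      · have h2' : (2 : ℝ≥0∞)⁻¹ = ENNReal.ofReal 2⁻¹ := by
          rw [ENNReal.ofReal_inv_of_pos (by norm_num)]; simp
        simp only [hg_def, Set.indicator_of_mem hp, Pi.one_apply, one_mul]
        rw [h2', ← ENNReal.ofReal_mul (by norm_num), Real.cosh_eq]
        congr 1
        ring
      · simp [hg_def, Set.indicator_of_notMem hp]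
    rw [← lintegral_indicator hA, lintegral_congr this,
      lintegral_const_mul _ (by fun_prop), lintegral_add_left (by fun_prop), h2, ← two_mul,
      ← mul_assoc, ENNReal.inv_mul_cancel (by norm_num) (by norm_num), one_mul]
  rw [h1, h3]

/-- Moving the candidate away from the origin inside the unit ball, along its ray, can reduce the
probability of an event about the clone distance only by a constant factor, uniform in the event:
`cosh` grows along the ray and the factor `exp (-‖x‖² / (2σ²))` stays above `exp (-1 / (2σ²))`. -/
theorem cloneDistProb_le_smul (k : ℕ) {σ : ℝ} (hσ : 0 < σ) {S : Set ℝ} (hS : MeasurableSet S)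
    {c : ℝ} (hc : 1 ≤ c) (x : Personality k) (hx : ‖c • x‖ ≤ 1) :
    cloneDistProb k σ S x ≤
      ENNReal.ofReal (Real.exp (1 / (2 * σ ^ 2))) * cloneDistProb k σ S (c • x) := by
  rw [cloneDistProb_eq k hσ hS, cloneDistProb_eq k hσ hS, ← mul_assoc,
    ← ENNReal.ofReal_mul (by positivity), ← Real.exp_add]
  gcongr ENNReal.ofReal (Real.exp ?_) * ?_
  · have h1 : ‖c • x‖ ^ 2 ≤ 1 := by
      have := norm_nonneg (c • x)
      nlinarith
    have hb : 0 < 1 / (2 * σ ^ 2) := by positivity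
    nlinarith [sq_nonneg ‖x‖]
  · refine lintegral_mono fun p => ENNReal.ofReal_le_ofReal ?_
    rw [Real.cosh_le_cosh, real_inner_smul_left, abs_div, abs_div, abs_mul]
    gcongr
    exact le_mul_of_one_le_left (abs_nonneg _) (hc.trans (le_abs_self c))

/-- Comparing the ball of radius `ρ` with the unit ball through `x ↦ ρ⁻¹ • x` gains the Jacobian `ρ ^ k`. -/
theorem setLIntegral_cloneDistProb_le (k : ℕ) {σ : ℝ} (hσ : 0 < σ) {S : Set ℝ}
    (hS : MeasurableSet S) {ρ : ℝ} (hρ : 0 < ρ) (hρ1 : ρ ≤ 1) :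
    ∫⁻ x in Metric.closedBall 0 ρ, cloneDistProb k σ S x ≤
      ENNReal.ofReal (Real.exp (1 / (2 * σ ^ 2)) * ρ ^ k) *
        ∫⁻ x in Metric.closedBall 0 1, cloneDistProb k σ S x := by
  have hpre : (fun x : Personality k => ρ⁻¹ • x) ⁻¹' Metric.closedBall 0 1 =
      Metric.closedBall 0 ρ := by
    ext x
    simp only [Set.mem_preimage, mem_closedBall_zero_iff, norm_smul, norm_inv, Real.norm_eq_abs,
      abs_of_pos hρ]
    rw [inv_mul_le_iff₀ hρ, mul_one]
  have hscale : ∫⁻ x in Metric.closedBall 0 ρ, cloneDistProb k σ S (ρ⁻¹ • x) =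
      ENNReal.ofReal (ρ ^ k) * ∫⁻ x in Metric.closedBall 0 1, cloneDistProb k σ S x := by
    rw [← hpre, ← setLIntegral_map Metric.isClosed_closedBall.measurableSet
      (measurable_cloneDistProb k σ hS) (by fun_prop),
      Measure.map_addHaar_smul _ (inv_ne_zero hρ.ne'), Measure.restrict_smul,
      lintegral_smul_measure, smul_eq_mul]
    congr 2
    simp [abs_of_pos hρ]
  calc ∫⁻ x in Metric.closedBall 0 ρ, cloneDistProb k σ S x
      ≤ ∫⁻ x in Metric.closedBall 0 ρ, ENNReal.ofReal (Real.exp (1 / (2 * σ ^ 2))) *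
          cloneDistProb k σ S (ρ⁻¹ • x) := by
        refine setLIntegral_mono' Metric.isClosed_closedBall.measurableSet fun x hx => ?_
        rw [← hpre] at hx
        exact cloneDistProb_le_smul k hσ hS ((one_le_inv₀ hρ).2 hρ1) x
          (mem_closedBall_zero_iff.1 hx)
    _ = _ := by
        have hm := measurable_cloneDistProb k σ hS
        rw [lintegral_const_mul _ (by fun_prop), hscale,
          ENNReal.ofReal_mul (by positivity), mul_assoc]

/-! ### A single interaction -/

theorem volume_closedBall_ne_zero (k : ℕ) {r : ℝ} (hr : 0 < r) :
    volume (Metric.closedBall (0 : Personality k) r) ≠ 0 :=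
  (Metric.measure_closedBall_pos volume _ hr).ne'

theorem volume_closedBall_ne_top (k : ℕ) (r : ℝ) :
    volume (Metric.closedBall (0 : Personality k) r) ≠ ∞ :=
  measure_closedBall_lt_top.ne

instance isProbabilityMeasure_uniformBall (k : ℕ) : IsProbabilityMeasure (uniformBall k) :=
  cond_isProbabilityMeasure_of_finite (volume_closedBall_ne_zero k one_pos)
    (volume_closedBall_ne_top k 1)

/-- The law of a single interaction on the platform. -/
def interactionLaw (k : ℕ) (σ : ℝ) : Measure (Interaction k) :=
  (uniformBall k).prod ((cloneNoise k σ).prod (cloneNoise k σ))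

instance isProbabilityMeasure_interactionLaw (k : ℕ) (σ : ℝ) :
    IsProbabilityMeasure (interactionLaw k σ) := by
  unfold interactionLaw; infer_instance

theorem measurable_cloneDist (k : ℕ) : Measurable (Interaction.cloneDist (k := k)) := by
  unfold Interaction.cloneDist Interaction.subjectClone Interaction.candidateClone
  fun_prop

theorem measurable_candidate (k : ℕ) : Measurable (Interaction.candidate (k := k)) :=
  measurable_fst

theorem interactionLaw_candidate_mem_closedBall (k : ℕ) (σ : ℝ) {S : Set ℝ}
    (hS : MeasurableSet S) {r : ℝ} (hr : r ≤ 1) :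
    interactionLaw k σ
        (Interaction.candidate ⁻¹' Metric.closedBall 0 r ∩ Interaction.cloneDist ⁻¹' S) =
      (volume (Metric.closedBall (0 : Personality k) 1))⁻¹ *
        ∫⁻ x in Metric.closedBall 0 r, cloneDistProb k σ S x := by
  have hB : MeasurableSet (Metric.closedBall (0 : Personality k) r) :=
    Metric.isClosed_closedBall.measurableSet
  rw [interactionLaw, Measure.prod_apply
    ((measurable_candidate k hB).inter (measurable_cloneDist k hS))]
  have : ∀ x : Personality k, ((cloneNoise k σ).prod (cloneNoise k σ)) (Prod.mk x ⁻¹'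
      (Interaction.candidate ⁻¹' Metric.closedBall 0 r ∩ Interaction.cloneDist ⁻¹' S)) =
      (Metric.closedBall 0 r).indicator (cloneDistProb k σ S) x := by
    intro x
    by_cases hx : x ∈ Metric.closedBall (0 : Personality k) r
    · rw [Set.indicator_of_mem hx, cloneDistProb]
      congr 1
      ext p
      simp only [Set.mem_preimage, Set.mem_inter_iff, Interaction.candidate, hx, true_and,
        Interaction.cloneDist, Interaction.subjectClone, Interaction.candidateClone, subject,
        zero_add]
      rfl
    · rw [Set.indicator_of_notMem hx]
      convert measure_empty
      · ext p
        simp only [Set.mem_preimage, Set.mem_inter_iff, Interaction.candidate, hx, false_and,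
          Set.mem_empty_iff_false]
      · infer_instance
  rw [lintegral_congr this, lintegral_indicator hB, uniformBall, ProbabilityTheory.cond,
    Measure.restrict_smul, lintegral_smul_measure, Measure.restrict_restrict hB,
    Set.inter_eq_left.2 (Metric.closedBall_subset_closedBall hr), smul_eq_mul]

/-- For small `ρ`, observing that the clone distance lies in `S` never makes it more likely than not
that the candidate is within `ρ` of Subject, whatever `S` is. -/
theorem interactionLaw_inter_le_half (k : ℕ) {σ : ℝ} (hσ : 0 < σ) {ρ : ℝ} (hρ : 0 < ρ)
    (hρ1 : ρ ≤ 1) (hρk : Real.exp (1 / (2 * σ ^ 2)) * ρ ^ k ≤ 2⁻¹) {S : Set ℝ}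
    (hS : MeasurableSet S) :
    interactionLaw k σ
        (Interaction.candidate ⁻¹' Metric.closedBall 0 ρ ∩ Interaction.cloneDist ⁻¹' S) ≤
      2⁻¹ * interactionLaw k σ (Interaction.cloneDist ⁻¹' S) := by
  have hhalf : ENNReal.ofReal (Real.exp (1 / (2 * σ ^ 2)) * ρ ^ k) ≤ 2⁻¹ := by
    refine (ENNReal.ofReal_le_ofReal hρk).trans_eq ?_
    rw [ENNReal.ofReal_inv_of_pos (by norm_num)]
    simp
  calc _ = (volume (Metric.closedBall (0 : Personality k) 1))⁻¹ *
        ∫⁻ x in Metric.closedBall 0 ρ, cloneDistProb k σ S x :=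
        interactionLaw_candidate_mem_closedBall k σ hS hρ1
    _ ≤ (volume (Metric.closedBall (0 : Personality k) 1))⁻¹ *
        (2⁻¹ * ∫⁻ x in Metric.closedBall 0 1, cloneDistProb k σ S x) := by
        gcongr
        exact (setLIntegral_cloneDistProb_le k hσ hS hρ hρ1).trans (by gcongr)
    _ = 2⁻¹ * interactionLaw k σ
        (Interaction.candidate ⁻¹' Metric.closedBall 0 1 ∩ Interaction.cloneDist ⁻¹' S) := by
        rw [interactionLaw_candidate_mem_closedBall k σ hS le_rfl, mul_left_comm]
    _ ≤ _ := by
        gcongr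
        exact Set.inter_subset_right

/-! ### The match among several candidates -/

/-- If `B` has conditional probability at most `c` given any event about `d`, then in an i.i.d. sample
the event that the `i`-th draw is in `B` has conditional probability at most `c` given any event about
all the values of `d`: freeze the draws other than the `i`-th. -/
theorem pi_inter_le_of_forall_inter_le {Ω : Type*} [MeasurableSpace Ω] (ν : Measure Ω)
    [IsProbabilityMeasure ν] {d : Ω → ℝ} (hd : Measurable d) {B : Set Ω} (hB : MeasurableSet B)
    {c : ℝ≥0∞} (h : ∀ S, MeasurableSet S → ν (B ∩ d ⁻¹' S) ≤ c * ν (d ⁻¹' S))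
    {n : ℕ} (i : Fin n) {T : Set (Fin n → ℝ)} (hT : MeasurableSet T) :
    Measure.pi (fun _ : Fin n => ν) {w | w i ∈ B ∧ (fun j => d (w j)) ∈ T} ≤
      c * Measure.pi (fun _ : Fin n => ν) {w | (fun j => d (w j)) ∈ T} := by
  obtain _ | n := n
  · exact i.elim0
  have he := measurePreserving_piFinSuccAbove (fun _ : Fin (n + 1) => ν) i
  -- `S f` is the set of values at coordinate `i` that put the whole list in `T`, given the others.
  set S : (Fin n → Ω) → Set ℝ := fun f =>
    {r | (i.insertNth r fun j => d (f j) : Fin (n + 1) → ℝ) ∈ T}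
  have hins : Measurable fun q : ℝ × (Fin n → Ω) =>
      (i.insertNth q.1 fun j => d (q.2 j) : Fin (n + 1) → ℝ) := by
    refine measurable_pi_lambda _ fun j => ?_
    refine Fin.succAboveCases i ?_ (fun j => ?_) j
    · simpa using measurable_fst
    · simp only [Fin.insertNth_apply_succAbove]
      fun_prop
  have hSm : ∀ f, MeasurableSet (S f) := fun f =>
    measurableSet_preimage (hins.comp (measurable_id.prodMk measurable_const)) hT
  set P : Set (Ω × (Fin n → Ω)) := {q | d q.1 ∈ S q.2}
  have hP : MeasurableSet P :=
    measurableSet_preimage (hins.comp ((hd.comp measurable_fst).prodMk measurable_snd)) hT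
  set Q : Set (Ω × (Fin n → Ω)) := {q | q.1 ∈ B ∧ d q.1 ∈ S q.2}
  have hQ : MeasurableSet Q := (measurable_fst hB).inter hP
  have hdw : ∀ w : Fin (n + 1) → Ω, (fun j => d (w j)) =
      (i.insertNth (d (w i)) fun j => d (w (i.succAbove j)) : Fin (n + 1) → ℝ) := by
    intro w
    funext j
    refine Fin.succAboveCases i ?_ (fun j => ?_) j <;> simp
  have h1 : {w : Fin (n + 1) → Ω | (fun j => d (w j)) ∈ T} =
      MeasurableEquiv.piFinSuccAbove (fun _ => Ω) i ⁻¹' P := by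
    ext w
    change (fun j => d (w j)) ∈ T ↔ _
    rw [hdw]
    rfl
  have h2 : {w : Fin (n + 1) → Ω | w i ∈ B ∧ (fun j => d (w j)) ∈ T} =
      MeasurableEquiv.piFinSuccAbove (fun _ => Ω) i ⁻¹' Q := by
    ext w
    change w i ∈ B ∧ (fun j => d (w j)) ∈ T ↔ _
    rw [hdw]
    rfl
  rw [h1, h2, he.measure_preimage hP.nullMeasurableSet, he.measure_preimage hQ.nullMeasurableSet,
    Measure.prod_apply_symm hP, Measure.prod_apply_symm hQ,
    ← lintegral_const_mul _ (measurable_measure_prodMk_right hP)]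
  exact lintegral_mono fun f => h (S f) (hSm f)

theorem measurable_argmin {n : ℕ} [NeZero n] : Measurable (argmin (n := n)) := by
  refine measurable_to_countable' fun i => ?_
  have hmin : ∀ j : Fin n, MeasurableSet {d : Fin n → ℝ | ∀ l, d j ≤ d l} := fun j => by
    rw [Set.ofPred_forall]
    exact MeasurableSet.iInter fun l =>
      measurableSet_le (measurable_pi_apply j) (measurable_pi_apply l)
  have : argmin ⁻¹' {i} = {d : Fin n → ℝ | ∀ l, d i ≤ d l} ∩
      ⋂ j, ⋂ (_ : j < i), {d : Fin n → ℝ | ∀ l, d j ≤ d l}ᶜ := by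
    ext d
    simp only [Set.mem_preimage, Set.mem_singleton_iff, argmin, Fin.find_eq_iff, Set.mem_inter_iff,
      Set.mem_iInter, Set.mem_compl_iff]
    rfl
  rw [this]
  exact (hmin i).inter (MeasurableSet.iInter fun j => MeasurableSet.iInter fun _ => (hmin j).compl)

theorem measurable_matchIndex {k n : ℕ} [NeZero n] : Measurable (matchIndex (k := k) (n := n)) := by
  have := measurable_cloneDist k
  exact measurable_argmin.comp (by fun_prop)

/-- Which index is selected depends on the clone distances only, so the bound for one interaction
holds given `matchIndex w = i` for each `i`, and summing over `i` gives it for the match. -/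
theorem platformLaw_match_mem_closedBall_le_half (k : ℕ) {σ : ℝ} (hσ : 0 < σ) {ρ : ℝ} (hρ : 0 < ρ)
    (hρ1 : ρ ≤ 1) (hρk : Real.exp (1 / (2 * σ ^ 2)) * ρ ^ k ≤ 2⁻¹) (n : ℕ) [NeZero n] :
    platformLaw k σ n {w | (w (matchIndex w)).candidate ∈ Metric.closedBall 0 ρ} ≤ 2⁻¹ := by
  have hm := measurable_cloneDist k
  have hprob : IsProbabilityMeasure (platformLaw k σ n) :=
    inferInstanceAs (IsProbabilityMeasure (Measure.pi fun _ : Fin n => interactionLaw k σ))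
  have hsub : {w : Fin n → Interaction k |
      (w (matchIndex w)).candidate ∈ Metric.closedBall 0 ρ} ⊆
      ⋃ i, {w | w i ∈ Interaction.candidate ⁻¹' Metric.closedBall 0 ρ ∧
        (fun j => (w j).cloneDist) ∈ argmin ⁻¹' {i}} := fun w hw =>
    Set.mem_iUnion.2 ⟨matchIndex w, hw, rfl⟩
  calc _ ≤ ∑ i, platformLaw k σ n {w | w i ∈ Interaction.candidate ⁻¹' Metric.closedBall 0 ρ ∧
        (fun j => (w j).cloneDist) ∈ argmin ⁻¹' {i}} :=
        (measure_mono hsub).trans (measure_iUnion_fintype_le _ _)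
    _ ≤ ∑ i, 2⁻¹ * platformLaw k σ n (matchIndex ⁻¹' {i}) := by
        refine Finset.sum_le_sum fun i _ => ?_
        exact pi_inter_le_of_forall_inter_le (interactionLaw k σ) hm
          (measurable_candidate k Metric.isClosed_closedBall.measurableSet)
          (fun S hS => interactionLaw_inter_le_half k hσ hρ hρ1 hρk hS) i
          (measurable_argmin (measurableSet_singleton i))
    _ = 2⁻¹ := by
        rw [← Finset.mul_sum, sum_measure_preimage_singleton _
          (fun i _ => measurable_matchIndex (measurableSet_singleton i))]
        simp

theorem ae_uniformBall_norm_le_one (k : ℕ) : ∀ᵐ x ∂(uniformBall k), ‖x‖ ≤ 1 := by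
  filter_upwards [ae_cond_mem Metric.isClosed_closedBall.measurableSet] with x hx
  exact mem_closedBall_zero_iff.1 hx

theorem half_le_platformDist (k : ℕ) {σ : ℝ} (hσ : 0 < σ) {ρ : ℝ} (hρ : 0 < ρ)
    (hρ1 : ρ ≤ 1) (hρk : Real.exp (1 / (2 * σ ^ 2)) * ρ ^ k ≤ 2⁻¹) (n : ℕ+) :
    ρ / 2 ≤ platformDist k σ n := by
  have hprob : IsProbabilityMeasure (platformLaw k σ n) :=
    inferInstanceAs (IsProbabilityMeasure (Measure.pi fun _ : Fin n => interactionLaw k σ))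
  set f : (Fin n → Interaction k) → ℝ := fun w => ‖(w (matchIndex w)).candidate - subject k‖
  have hcand : Measurable fun w : Fin n → Interaction k => (w (matchIndex w)).candidate := by
    have : Measurable fun q : (Fin n → Interaction k) × Fin n => (q.1 q.2).candidate :=
      measurable_from_prod_countable_left fun i => (measurable_candidate k).comp
        (measurable_pi_apply i)
    exact this.comp (measurable_id.prodMk measurable_matchIndex)
  have hf : Measurable f := (hcand.sub measurable_const).norm
  have hf_eq : ∀ w, f w = ‖(w (matchIndex w)).candidate‖ := fun w => by
    simp only [f, subject, sub_zero]
  have hbound : ∀ᵐ w ∂(platformLaw k σ n), ‖f w‖ ≤ 1 := by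
    have h1 : ∀ᵐ w ∂(interactionLaw k σ), ‖w.candidate‖ ≤ 1 :=
      Measure.quasiMeasurePreserving_fst.ae (ae_uniformBall_norm_le_one k)
    have h2 : ∀ᵐ w ∂(platformLaw k σ n), ∀ i, ‖(w i).candidate‖ ≤ 1 :=
      ae_all_iff.2 fun i => (Measure.quasiMeasurePreserving_eval
        (fun _ : Fin n => interactionLaw k σ) i).ae h1
    filter_upwards [h2] with w hw
    rw [hf_eq, norm_norm]
    exact hw _
  have hint : Integrable f (platformLaw k σ n) :=
    Integrable.of_bound hf.aestronglyMeasurable 1 hbound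
  set near : Set (Fin n → Interaction k) :=
    {w | (w (matchIndex w)).candidate ∈ Metric.closedBall 0 ρ}
  have hnear : MeasurableSet near := hcand Metric.isClosed_closedBall.measurableSet
  have hnear_le : (platformLaw k σ n).real near ≤ 2⁻¹ := by
    have := ENNReal.toReal_mono (by norm_num)
      (platformLaw_match_mem_closedBall_le_half k hσ hρ hρ1 hρk n)
    rwa [ENNReal.toReal_inv, ENNReal.toReal_ofNat] at this
  have hsub : nearᶜ ⊆ {w | ρ ≤ f w} := by
    intro w hw
    change ρ ≤ f w
    rw [hf_eq]
    exact (not_le.1 (mt mem_closedBall_zero_iff.2 hw)).le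
  have hfar_le : 2⁻¹ ≤ (platformLaw k σ n).real {w | ρ ≤ f w} := by
    have := measureReal_mono (μ := platformLaw k σ n) hsub
    rw [probReal_compl_eq_one_sub hnear] at this
    linarith
  calc ρ / 2 = ρ * 2⁻¹ := div_eq_mul_inv _ _
    _ ≤ ρ * (platformLaw k σ n).real {w | ρ ≤ f w} := by gcongr
    _ ≤ platformDist k σ n :=
        mul_meas_ge_le_integral_of_nonneg (.of_forall fun w => norm_nonneg _) hint ρ

/-! ### In-person draws and the comparison -/

/-- The in-person distance gets arbitrarily small: up to `δ / 2`, it is at most the probability that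
all draws are farther than `δ / 2`, which decays geometrically. -/
theorem exists_inPersonDist_lt (k : ℕ) {δ : ℝ} (hδ : 0 < δ) :
    ∃ m : ℕ+, inPersonDist k m < δ := by
  set μ := uniformBall k
  set A : Set (Personality k) := (Metric.closedBall 0 (δ / 2))ᶜ
  have hA : MeasurableSet A := Metric.isClosed_closedBall.measurableSet.compl
  have hq : μ.real A < 1 := by
    rw [probReal_compl_eq_one_sub Metric.isClosed_closedBall.measurableSet, sub_lt_self_iff,
      measureReal_def]
    refine ENNReal.toReal_pos ?_ (measure_ne_top _ _)
    have : μ (Metric.closedBall 0 (δ / 2)) = (volume (Metric.closedBall (0 : Personality k) 1))⁻¹ *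
        volume (Metric.closedBall (0 : Personality k) 1 ∩ Metric.closedBall 0 (δ / 2)) :=
      cond_apply Metric.isClosed_closedBall.measurableSet _ _
    rw [this]
    refine mul_ne_zero (ENNReal.inv_ne_zero.2 (volume_closedBall_ne_top k 1)) fun h0 => ?_
    refine volume_closedBall_ne_zero k (lt_min one_pos (half_pos hδ)) (measure_mono_null ?_ h0)
    exact Set.subset_inter (Metric.closedBall_subset_closedBall (min_le_left _ _))
      (Metric.closedBall_subset_closedBall (min_le_right _ _))
  obtain ⟨m, hm⟩ := exists_pow_lt_of_lt_one (half_pos hδ) hq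
  refine ⟨m.succPNat, ?_⟩
  have hprob : IsProbabilityMeasure (inPersonLaw k (m + 1)) :=
    inferInstanceAs (IsProbabilityMeasure (Measure.pi fun _ : Fin (m + 1) => uniformBall k))
  set far : Set (Fin (m + 1) → Personality k) := Set.univ.pi fun _ => A
  have hfar : MeasurableSet far := MeasurableSet.univ_pi fun _ => hA
  have hfar_real : (inPersonLaw k (m + 1)).real far = μ.real A ^ (m + 1) := by
    simp [measureReal_def, inPersonLaw, far, Measure.pi_pi, ENNReal.toReal_pow, μ]
  have hae : ∀ᵐ x ∂(inPersonLaw k (m + 1)), ∀ i, ‖x i‖ ≤ 1 :=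
    ae_all_iff.2 fun i => (Measure.quasiMeasurePreserving_eval
      (fun _ : Fin (m + 1) => uniformBall k) i).ae (ae_uniformBall_norm_le_one k)
  change ∫ x, ⨅ i, ‖x i - subject k‖ ∂(inPersonLaw k (m + 1)) < δ
  have hle : ∫ x, ⨅ i, ‖x i - subject k‖ ∂(inPersonLaw k (m + 1)) ≤
      ∫ x, (δ / 2 + far.indicator 1 x) ∂(inPersonLaw k (m + 1)) := by
    refine integral_mono_of_nonneg (.of_forall fun x => Real.iInf_nonneg fun i => norm_nonneg _)
      ((integrable_const _).add ((integrable_const 1).indicator hfar)) ?_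
    filter_upwards [hae] with x hx
    have hinf : ∀ i, ⨅ j, ‖x j - subject k‖ ≤ ‖x i‖ := fun i => by
      refine (ciInf_le (Set.finite_range _).bddBelow i).trans_eq ?_
      rw [subject, sub_zero]
    by_cases hxf : x ∈ far
    · -- When all draws are far, the distance is still at most `1`.
      rw [Set.indicator_of_mem hxf]
      refine (hinf 0).trans ((hx 0).trans ?_)
      simpa using (half_pos hδ).le
    · rw [Set.indicator_of_notMem hxf, add_zero]
      have : ∃ i, x i ∈ Metric.closedBall (0 : Personality k) (δ / 2) := by
        by_contra hcon
        exact hxf fun i _ => not_exists.1 hcon i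
      obtain ⟨i, hi⟩ := this
      exact (hinf i).trans (mem_closedBall_zero_iff.1 hi)
  rw [integral_add (integrable_const _) ((integrable_const 1).indicator hfar),
    integral_indicator_one hfar, integral_const, probReal_univ, one_smul, hfar_real] at hle
  have hpow : μ.real A ^ (m + 1) ≤ μ.real A ^ m :=
    pow_le_pow_of_le_one measureReal_nonneg hq.le m.le_succ
  linarith

theorem exists_beatsPlatform {k : ℕ} (hk : 1 ≤ k) {σ : ℝ} (hσ : 0 < σ) :
    ∃ m : ℕ+, BeatsPlatform k σ m := by
  set E := Real.exp (1 / (2 * σ ^ 2)) with hE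
  have hE1 : 1 ≤ E := Real.one_le_exp (by positivity)
  -- As `k ≥ 1`, `E * ρ ^ k ≤ E * ρ`; this is where `k = 0` would fail.
  set ρ : ℝ := (2 * E)⁻¹ with hρ_def
  have hρ : 0 < ρ := by positivity
  have hρ1 : ρ ≤ 1 := inv_le_one_of_one_le₀ (by linarith)
  have hρk : E * ρ ^ k ≤ 2⁻¹ := by
    calc E * ρ ^ k ≤ E * ρ ^ 1 := by
          gcongr E * ?_
          exact pow_le_pow_of_le_one hρ.le hρ1 hk
      _ = 2⁻¹ := by rw [hρ_def]; field_simp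
  obtain ⟨m, hm⟩ := exists_inPersonDist_lt k (half_pos hρ)
  exact ⟨m, fun n => hm.trans_le (half_le_platformDist k hσ hρ hρ1 hρk n)⟩

end CloneSearch

end

theorem proposition1 (k : ℕ) (hk : 1 ≤ k) (σ : ℝ) (hσ : 0 < σ) :
    ∃ m : ℕ+, CloneSearch.aiEquivalentSampleSize k σ = ((m : ℕ) : ℕ∞) ∧
      ∀ n : ℕ+, CloneSearch.inPersonDist k m < CloneSearch.platformDist k σ n := by
  classical
  have h := CloneSearch.exists_beatsPlatform hk hσ
  refine ⟨PNat.find h, le_antisymm (iInf₂_le _ (PNat.find_spec h)) ?_, PNat.find_spec h⟩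
  refine le_iInf₂ fun m hm => ?_
  exact_mod_cast PNat.find_min' h hm
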